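/- There are absolute constants $C_1, C_2>0$ such that the following holds. Let $[n]=\{1,\dots,n\}$ be partitioned into clusters $C_1^*,\dots,C_r^*$, let $\theta\in\mathbb{R}^n$ with $\theta_i\ge 0$, and let $B\in\mathbb{R}^{r\times r}$ be a symmetric matrix with nonnegative entries such that $\theta_i\theta_jB_{ab}\in[0,1]$ for all $i\in C_a^*$, $j\in C_b^*$, including $i=j$. Let $G$ be a random graph on $[n]$ (degree-corrected stochastic block model) in which each pair of distinct nodes $i\in C_a^*$, $j\in C_b^*$ is joined by an edge with probability $\theta_i\theta_jB_{ab}$, independently over the pairs. Let $A$ be its adjacency matrix and $d=(d_1,\dots,d_n)^\top$, $d_i=\sum_jA_{ij}$, its degree vector. Assume that the model is an $\mathcal{F}(n,r,p,q,g)$-model: $B_{aa}=p$ for all $a$, $B_{ab}=q$ for all $a\ne b$, and $\sum_{i\in C_a^*}\theta_i=g$ for all $a$, where $q\ge 0$. Let $\delta>0$ and $\lambda$ satisfy $$p-q>2\delta\quad\text{and}\quad \frac{q+\delta}{(p+(r-1)q)^2g^2}<\lambda<\frac{p-\delta}{(p+(r-1)q)^2g^2}.$$ Let $Y^*\in\{0,1\}^{n\times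 n}$ be the true partition matrix, with $Y^*_{ij}=1$ if and only if $i$ and $j$ lie in the same cluster, and write $\|Z\|_{1,\theta}=\sum_{i,j}|\theta_iZ_{ij}\theta_j|$. Then with probability at least $0.99-2(e/2)^{-2n}$, every optimal solution $\widehat Y$ of the convex program $$\max_Y\ \langle Y,\,A-\lambda dd^\top\rangle\quad\text{subject to } Y\succeq 0,\quad 0\le Y_{ij}\le 1\ (i,j\in[n]),\quad Y_{ii}=1\ (i\in[n])$$ satisfies $$\|Y^*-\widehat Y\|_{1,\theta}\le \frac{C_1}{\delta}\Bigl(1+\frac{rp}{p+(r-1)q}\Bigr)\bigl(n+rg\sqrt{np}\bigr),$$ and moreover $$\frac{1}{\delta}\Bigl(1+\frac{rp}{p+(r-1)q}\Bigr)\bigl(n+rg\sqrt{np}\bigr)\le \frac{C_2\,r}{\delta}\bigl(n+rg\sqrt{np}\bigr).$$ -/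

import Mathlib

open MeasureTheory ProbabilityTheory

noncomputable section

/-- The parameters of a degree-corrected stochastic block model on the nodes `Fin n` with clusters
indexed by `Fin r`: `cluster i` is the true cluster of node `i`, `θ` is the vector of degree
heterogeneity parameters and `B` is the connectivity matrix. All the numbers `θ_i θ_j B_{ab}`,
where `a`, `b` are the clusters of `i`, `j`, lie in `[0, 1]`, including those with `i = j`. -/
structure DCSBM (n r : ℕ) where
  cluster : Fin n → Fin r
  θ : Fin n → ℝ
  B : Matrix (Fin r) (Fin r) ℝ
  θ_nonneg : ∀ i, 0 ≤ θ i
  B_symm : B.IsSymm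
  B_nonneg : ∀ a b, 0 ≤ B a b
  edgeProb_le_one : ∀ i j, θ i * θ j * B (cluster i) (cluster j) ≤ 1

namespace DCSBM

variable {n r : ℕ}

/-- `G_a`, the sum of the degree heterogeneity parameters in the cluster `a`. -/
def clusterWeight (M : DCSBM n r) (a : Fin r) : ℝ :=
  ∑ i with M.cluster i = a, M.θ i

/-- The true partition matrix `Y*`. -/
def trueY (M : DCSBM n r) : Matrix (Fin n) (Fin n) ℝ :=
  Matrix.of fun i j => if M.cluster i = M.cluster j then 1 else 0

/-- The weighted entrywise norm `‖Z‖_{1,θ}`. -/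
def weightedNorm (M : DCSBM n r) (Z : Matrix (Fin n) (Fin n) ℝ) : ℝ :=
  ∑ i, ∑ j, |M.θ i * Z i j * M.θ j|

/-- The model is an `F(n, r, p, q, g)`-model. -/
structure IsFModel (M : DCSBM n r) (p q g : ℝ) : Prop where
  diag : ∀ a, M.B a a = p
  offDiag : ∀ a b, a < b → M.B a b = q
  weight : ∀ a, M.clusterWeight a = g

/-- The random graph `G`, defined on the probability space `(Ω, P)`, is generated by the model:
distinct nodes `i`, `j` are joined with probability `θ_i θ_j B_{ab}`, where `a`, `b` are their
clusters, independently over the unordered pairs of distinct nodes. -/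
structure IsRandomGraph {Ω : Type*} [MeasurableSpace Ω] (M : DCSBM n r) (P : Measure Ω)
    (G : Ω → SimpleGraph (Fin n)) : Prop where
  measurableSet_adj : ∀ i j, MeasurableSet {ω | (G ω).Adj i j}
  prob_adj : ∀ i j, i ≠ j →
    P.real {ω | (G ω).Adj i j} = M.θ i * M.θ j * M.B (M.cluster i) (M.cluster j)
  indep : iIndepSet
    (fun e : {e : Fin n × Fin n // e.1 < e.2} => {ω | (G ω).Adj e.1.1 e.1.2}) P

end DCSBM

namespace CMM

variable {n : ℕ}

open Classical in
/-- The adjacency matrix `A` of a graph. -/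
def adj (G : SimpleGraph (Fin n)) : Matrix (Fin n) (Fin n) ℝ := G.adjMatrix ℝ

/-- The degree vector `d_i = ∑_j A_{ij}`. -/
def deg (G : SimpleGraph (Fin n)) (i : Fin n) : ℝ := ∑ j, adj G i j

/-- The objective `⟨Y, A - lam d dᵀ⟩` of the convex relaxation. -/
def objective (G : SimpleGraph (Fin n)) (lam : ℝ) (Y : Matrix (Fin n) (Fin n) ℝ) : ℝ :=
  ∑ i, ∑ j, Y i j * (adj G i j - lam * (deg G i * deg G j))

/-- The feasible set of the convex relaxation. -/
def feasible (n : ℕ) : Set (Matrix (Fin n) (Fin n) ℝ) :=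
  {Y | Y.PosSemidef ∧ (∀ i j, 0 ≤ Y i j ∧ Y i j ≤ 1) ∧ ∀ i, Y i i = 1}

/-- `Y` is an optimal solution of the convex relaxation. -/
def IsSolution (G : SimpleGraph (Fin n)) (lam : ℝ) (Y : Matrix (Fin n) (Fin n) ℝ) : Prop :=
  Y ∈ feasible n ∧ ∀ Z ∈ feasible n, objective G lam Z ≤ objective G lam Y

/-- An optimal solution always exists. -/
theorem exists_isSolution (G : SimpleGraph (Fin n)) (lam : ℝ) : ∃ Y, IsSolution G lam Y := by
  have hK : IsCompact (Set.univ.pi fun _ : Fin n => Set.univ.pi fun _ : Fin n =>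
      Set.Icc (0 : ℝ) 1) :=
    isCompact_univ_pi fun _ => isCompact_univ_pi fun _ => isCompact_Icc
  have hcl : IsClosed (feasible n) := by
    have h : feasible n = {Y | (∀ i j, Y j i = Y i j) ∧
        (∀ x : Fin n → ℝ, 0 ≤ star x ⬝ᵥ (Y.mulVec x)) ∧
        (∀ i j, 0 ≤ Y i j ∧ Y i j ≤ 1) ∧ ∀ i, Y i i = 1} := by
      ext Y
      simp only [feasible, Set.mem_ofPred_eq, Matrix.posSemidef_iff_dotProduct_mulVec,
        Matrix.IsHermitian.ext_iff, star_trivial, and_assoc]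
    rw [h]
    simp only [Set.ofPred_and, Set.ofPred_forall]
    refine IsClosed.inter ?_ (IsClosed.inter ?_ (IsClosed.inter ?_ ?_))
    · exact isClosed_iInter fun i => isClosed_iInter fun j =>
        isClosed_eq (by fun_prop) (by fun_prop)
    · refine isClosed_iInter fun x => isClosed_le continuous_const ?_
      unfold dotProduct Matrix.mulVec dotProduct
      fun_prop
    · exact isClosed_iInter fun i => isClosed_iInter fun j =>
        (isClosed_le continuous_const (by fun_prop)).inter
          (isClosed_le (by fun_prop) continuous_const)
    · exact isClosed_iInter fun i => isClosed_eq (by fun_prop) continuous_const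
  have hc : IsCompact (feasible n) :=
    hK.of_isClosed_subset hcl fun Y hY => by
      simp only [Set.mem_pi, Set.mem_univ, true_implies]
      exact fun i j => hY.2.1 i j
  have hne : (feasible n).Nonempty := by
    refine ⟨1, Matrix.PosSemidef.one, fun i j => ?_, fun i => by simp⟩
    by_cases h : i = j <;> simp [Matrix.one_apply, h]
  obtain ⟨Y, hY, hmax⟩ := hc.exists_isMaxOn hne
    (f := objective G lam) (by unfold objective; fun_prop)
  exact ⟨Y, hY, fun Z hZ => hmax hZ⟩

end CMM

end

/-! Write K = p + (r-1)q and κ = gK. The mean degree of node i is θ_i κ up to the diagonal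
correction p θ_i², and the window for λ says exactly that q + δ < λκ² < p - δ. Hence the population
matrix with entries θ_i θ_j (B_ab - λκ²) is at least δ θ_i θ_j inside clusters and at most -δ θ_i
θ_j across them, so Y* beats any feasible Y there by at least δ‖Y* - Y‖_{1,θ} (`gap_le`).

Let E A be the mean adjacency matrix, with zero diagonal. If Y is optimal for the observed matrix,
this gap is at most ⟨Y - Y*, A - E A⟩ + λ⟨Y* - Y, dd^T - κ²θθ^T⟩. Grothendieck's inequality bounds
the first term by the maximum of A - E A over sign vectors, which a Bernstein bound and a union over
4^n sign pairs control. The second is bounded through the ℓ¹ error of the degrees, which variances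
and Markov's inequality control at the cost of probability 0.01.

With s = √(n r g κ) ≤ r g √(np), the first term is O(n + s). The second is O(λ r g κ (n + s)), and λ
r g κ ≤ rp/K, which produces the factor 1 + rp/K. -/

/-! ### Rademacher sums and truncation. -/

/-- The sign `±1` encoded by a Boolean. -/
def boolSign (b : Bool) : ℝ := if b then 1 else -1

/-- Every real number is turned into its absolute value by a sign. -/
theorem exists_boolSign_mul (a : ℝ) : ∃ b, boolSign b * a = |a| := by
  rcases le_total 0 a with h | h
  · exact ⟨true, by simp [boolSign, abs_of_nonneg h]⟩
  · exact ⟨false, by simp [boolSign, abs_of_nonpos h]⟩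

/-- The Rademacher sum with coefficients `u` at the sign pattern `x`. -/
def rademacherSum {m : ℕ} (u : Fin m → ℝ) (x : Fin m → Bool) : ℝ := ∑ k, boolSign (x k) * u k

theorem sum_boolPattern_succ {m : ℕ} (F : (Fin (m + 1) → Bool) → ℝ) :
    ∑ x, F x = ∑ x : Fin m → Bool, (F (Fin.cons true x) + F (Fin.cons false x)) := by
  rw [← (Fin.consEquiv fun _ => Bool).sum_comp F, Fintype.sum_prod_type, Fintype.sum_bool,
    ← Finset.sum_add_distrib]
  rfl

theorem rademacherSum_cons {m : ℕ} (u : Fin (m + 1) → ℝ) (b : Bool) (x : Fin m → Bool) :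
    rademacherSum u (Fin.cons b x) = boolSign b * u 0 + rademacherSum (fun k => u k.succ) x := by
  simp [rademacherSum, Fin.sum_univ_succ]

theorem sum_rademacherSum_mul {m : ℕ} (u v : Fin m → ℝ) :
    ∑ x, rademacherSum u x * rademacherSum v x = 2 ^ m * ∑ k, u k * v k := by
  induction m with
  | zero => simp [rademacherSum]
  | succ m ih =>
    have hp : (2 : ℝ) ^ (m + 1) * (u 0 * v 0 + ∑ k : Fin m, u k.succ * v k.succ)
        = 2 ^ m * 2 * (u 0 * v 0) + 2 * (2 ^ m * ∑ k : Fin m, u k.succ * v k.succ) := by ring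
    rw [sum_boolPattern_succ, Fin.sum_univ_succ, hp, ← ih]
    simp only [rademacherSum_cons, boolSign]
    rw [Finset.mul_sum]
    have : (2 : ℝ) ^ m * 2 * (u 0 * v 0) = ∑ _x : Fin m → Bool, 2 * (u 0 * v 0) := by
      simp [mul_assoc]
    rw [this, ← Finset.sum_add_distrib]
    refine Finset.sum_congr rfl fun x _ => ?_
    simp only [if_true, Bool.false_eq_true, if_false]
    ring

/-- Khintchine's fourth-moment bound. Averaging over the first sign kills the odd powers; the
surviving cross term is evaluated by orthogonality. -/
theorem sum_rademacherSum_pow_four_le {m : ℕ} (u : Fin m → ℝ) :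
    ∑ x, rademacherSum u x ^ 4 ≤ 2 ^ m * (3 * (∑ k, u k ^ 2) ^ 2) := by
  induction m with
  | zero => simp [rademacherSum]
  | succ m ih =>
    have h2 := sum_rademacherSum_mul (fun k : Fin m => u k.succ) (fun k => u k.succ)
    have h4 := ih fun k => u k.succ
    rw [sum_boolPattern_succ, Fin.sum_univ_succ]
    simp only [rademacherSum_cons, boolSign, if_true, Bool.false_eq_true, if_false]
    set X := rademacherSum fun k : Fin m => u k.succ
    set s := ∑ k : Fin m, u k.succ ^ 2
    have hs : ∑ k : Fin m, u k.succ * u k.succ = s := Finset.sum_congr rfl fun k _ => by ring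
    have e : ∑ x, ((1 * u 0 + X x) ^ 4 + (-1 * u 0 + X x) ^ 4)
        = 2 ^ m * (2 * u 0 ^ 4) + 12 * u 0 ^ 2 * ∑ x, X x * X x + 2 * ∑ x, X x ^ 4 := by
      have : (2 : ℝ) ^ m * (2 * u 0 ^ 4) = ∑ _x : Fin m → Bool, 2 * u 0 ^ 4 := by simp
      rw [this, Finset.mul_sum, Finset.mul_sum, ← Finset.sum_add_distrib,
        ← Finset.sum_add_distrib]
      exact Finset.sum_congr rfl fun x _ => by ring
    rw [e, h2, hs, pow_succ 2 m]
    have : 0 ≤ (2 : ℝ) ^ m * u 0 ^ 4 := by positivity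
    nlinarith

/-- The truncation of a real number to `[-R, R]`. -/
def truncate (R t : ℝ) : ℝ := max (-R) (min R t)

theorem abs_truncate_le {R : ℝ} (hR : 0 ≤ R) (t : ℝ) : |truncate R t| ≤ R :=
  abs_le.2 ⟨le_max_left _ _, max_le (by linarith) (min_le_left _ _)⟩

theorem truncate_sq_le {R : ℝ} (hR : 0 ≤ R) (t : ℝ) : truncate R t ^ 2 ≤ t ^ 2 := by
  refine sq_le_sq.2 ?_
  unfold truncate
  rcases le_total R t with h | h
  · rw [min_eq_left h, max_eq_right (by linarith), abs_of_nonneg hR]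
    exact h.trans (le_abs_self t)
  · rw [min_eq_right h]
    rcases le_total (-R) t with h' | h'
    · rw [max_eq_right h']
    · rw [max_eq_left h', abs_neg, abs_of_nonneg hR]
      exact (by linarith : R ≤ -t).trans (neg_le_abs t)

/-- A fourth-moment bound thereby makes the truncation error small in L² when R is large. -/
theorem sub_truncate_sq_le {R : ℝ} (hR : 0 ≤ R) (t : ℝ) :
    R ^ 2 * (t - truncate R t) ^ 2 ≤ t ^ 4 := by
  unfold truncate
  have key : ∀ x : ℝ, R ≤ x → R ^ 2 * (x - R) ^ 2 ≤ x ^ 4 := fun x hx => by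
    have h1 : R * (x - R) ≤ x ^ 2 := by nlinarith
    have h0 : 0 ≤ R * (x - R) := mul_nonneg hR (by linarith)
    calc _ = (R * (x - R)) ^ 2 := by ring
      _ ≤ (x ^ 2) ^ 2 := pow_le_pow_left₀ h0 h1 2
      _ = _ := by ring
  rcases le_total R t with h | h
  · rw [min_eq_left h, max_eq_right (by linarith)]
    exact key t h
  · rw [min_eq_right h]
    rcases le_total (-R) t with h' | h'
    · rw [max_eq_right h', sub_self]
      simpa using (by positivity : 0 ≤ t ^ 4)
    · rw [max_eq_left h']
      calc _ = R ^ 2 * (-t - R) ^ 2 := by ring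
        _ ≤ (-t) ^ 4 := key (-t) (by linarith)
        _ = _ := by ring

/-! ### Grothendieck's inequality. -/

section Grothendieck

variable {ι : Type*} [Fintype ι] {M : ι → ι → ℝ} {T : ℝ}

theorem signBound_nonneg
    (h : ∀ x y : ι → Bool, ∑ i, ∑ j, M i j * (boolSign (x i) * boolSign (y j)) ≤ T) : 0 ≤ T := by
  have h1 := h (fun _ => true) fun _ => true
  have h2 := h (fun _ => false) fun _ => true
  simp only [boolSign, if_true, Bool.false_eq_true, if_false, mul_one, mul_neg,
    Finset.sum_neg_distrib] at h1 h2
  linarith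

/-- A bilinear form bounded by `T` on sign vectors is bounded by `T` on the cube `[-1, 1]^ι`. -/
theorem sum_mul_le_of_signBound
    (h : ∀ x y : ι → Bool, ∑ i, ∑ j, M i j * (boolSign (x i) * boolSign (y j)) ≤ T)
    {a b : ι → ℝ} {R : ℝ} (ha : ∀ i, |a i| ≤ R) (hb : ∀ i, |b i| ≤ R) :
    ∑ i, ∑ j, M i j * (a i * b j) ≤ R ^ 2 * T := by
  rcases isEmpty_or_nonempty ι with _ | ⟨⟨i₀⟩⟩
  · simpa using mul_nonneg (sq_nonneg R) (signBound_nonneg h)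
  have hR : 0 ≤ R := (abs_nonneg _).trans (ha i₀)
  -- A bilinear form is maximal at vertices of the cube: replace a by optimal signs, then b.
  choose x hx using fun i => exists_boolSign_mul (∑ j, M i j * b j)
  choose y hy using fun j => exists_boolSign_mul (∑ i, M i j * boolSign (x i))
  calc ∑ i, ∑ j, M i j * (a i * b j) = ∑ i, a i * ∑ j, M i j * b j := by
        simp only [Finset.mul_sum]
        exact Finset.sum_congr rfl fun i _ => Finset.sum_congr rfl fun j _ => by ring
    _ ≤ ∑ i, R * (boolSign (x i) * ∑ j, M i j * b j) := by
        refine Finset.sum_le_sum fun i _ => ?_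
        rw [hx]
        refine (le_abs_self _).trans ?_
        rw [abs_mul]
        exact mul_le_mul_of_nonneg_right (ha i) (abs_nonneg _)
    _ = ∑ j, R * (b j * ∑ i, M i j * boolSign (x i)) := by
        simp only [Finset.mul_sum]
        rw [Finset.sum_comm]
        exact Finset.sum_congr rfl fun i _ => Finset.sum_congr rfl fun j _ => by ring
    _ ≤ ∑ j, R * (R * (boolSign (y j) * ∑ i, M i j * boolSign (x i))) := by
        refine Finset.sum_le_sum fun j _ => mul_le_mul_of_nonneg_left ?_ hR
        rw [hy]
        refine (le_abs_self _).trans ?_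
        rw [abs_mul]
        exact mul_le_mul_of_nonneg_right (hb j) (abs_nonneg _)
    _ = R ^ 2 * ∑ i, ∑ j, M i j * (boolSign (x i) * boolSign (y j)) := by
        rw [Finset.sum_comm, Finset.mul_sum]
        refine Finset.sum_congr rfl fun i _ => ?_
        simp only [Finset.mul_sum]
        exact Finset.sum_congr rfl fun j _ => by ring
    _ ≤ R ^ 2 * T := mul_le_mul_of_nonneg_left (h x y) (sq_nonneg R)

/-- Self-improvement: Rademacher sums embed the vectors isometrically into L² of the sign cube.
Truncated at R, they contribute at most R²T = 48T by the cube bound. The remainders have norm at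
most 1/4, so the two remaining terms cost 1/4 each of the bound being proved. Thus a bound K
improves to 48T + K/2, with fixed point 96T; k counts the iterations, starting from the trivial
bound. The embedding raises the dimension to 2^m, so the induction must cover every m. -/
theorem sum_mul_sum_le_aux
    (h : ∀ x y : ι → Bool, ∑ i, ∑ j, M i j * (boolSign (x i) * boolSign (y j)) ≤ T) (k m : ℕ)
    (u v : ι → Fin m → ℝ) (hu : ∀ i, ∑ l, u i l ^ 2 ≤ 1) (hv : ∀ i, ∑ l, v i l ^ 2 ≤ 1) :
    ∑ i, ∑ j, M i j * ∑ l, u i l * v j l ≤ 96 * T + (1 / 2) ^ k * ∑ i, ∑ j, |M i j| := by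
  have hT := signBound_nonneg h
  induction k generalizing m with
  | zero =>
    have : ∑ i, ∑ j, M i j * ∑ l, u i l * v j l ≤ ∑ i, ∑ j, |M i j| := by
      refine Finset.sum_le_sum fun i _ => Finset.sum_le_sum fun j _ => ?_
      refine (le_abs_self _).trans ?_
      rw [abs_mul]
      refine mul_le_of_le_one_right (abs_nonneg _) ?_
      rw [← sq_le_one_iff_abs_le_one]
      exact (Finset.sum_mul_sq_le_sq_mul_sq _ _ _).trans
        (mul_le_one₀ (hu i) (Finset.sum_nonneg fun _ _ => sq_nonneg _) (hv j))
    simp only [pow_zero, one_mul]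
    linarith
  | succ k ih =>
    have ih' : ∀ a b : ι → (Fin m → Bool) → ℝ, (∀ i, ∑ x, a i x ^ 2 ≤ 1) →
        (∀ i, ∑ x, b i x ^ 2 ≤ 1) → ∑ i, ∑ j, M i j * ∑ x, a i x * b j x
          ≤ 96 * T + (1 / 2) ^ k * ∑ i, ∑ j, |M i j| := fun a b ha hb => by
      let e := Fintype.equivFin (Fin m → Bool)
      have := ih _ (fun i l => a i (e.symm l)) (fun i l => b i (e.symm l))
        (fun i => (e.symm.sum_comp fun x => a i x ^ 2).trans_le (ha i))
        (fun i => (e.symm.sum_comp fun x => b i x ^ 2).trans_le (hb i))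
      refine le_of_eq_of_le (Finset.sum_congr rfl fun i _ => Finset.sum_congr rfl fun j _ => ?_) this
      rw [e.symm.sum_comp fun x => a i x * b j x]
    -- With fourth moment at most 3, the remainder has squared norm at most 3/48 = (1/4)².
    set R : ℝ := √48
    have hR : 0 ≤ R := Real.sqrt_nonneg _
    have hR2 : R ^ 2 = 48 := Real.sq_sqrt (by norm_num)
    set c : ℝ := √(2 ^ m)
    have hc0 : 0 < c := Real.sqrt_pos.2 (by positivity)
    have hc2 : c ^ 2 = 2 ^ m := Real.sq_sqrt (by positivity)
    -- the sum is an average over sign patterns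
    have havg : ∀ w z : Fin m → ℝ, ∑ l, w l * z l
        = (∑ x, rademacherSum w x * rademacherSum z x) / c ^ 2 := fun w z => by
      rw [sum_rademacherSum_mul, hc2, mul_div_cancel_left₀ _ (by positivity)]
    have hfull : ∀ w : Fin m → ℝ, ∑ l, w l ^ 2 ≤ 1 → ∑ x, (rademacherSum w x / c) ^ 2 ≤ 1 :=
      fun w hw => by
        simp only [div_pow, ← Finset.sum_div]
        have := havg w w
        simp only [← sq] at this
        rwa [← this]
    have htrunc : ∀ w : Fin m → ℝ, ∑ l, w l ^ 2 ≤ 1 →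
        ∑ x, (truncate R (rademacherSum w x) / c) ^ 2 ≤ 1 := fun w hw => by
      refine (Finset.sum_le_sum fun x _ => ?_).trans (hfull w hw)
      rw [div_pow, div_pow]
      exact div_le_div_of_nonneg_right (truncate_sq_le hR _) (sq_nonneg c)
    have hrest : ∀ w : Fin m → ℝ, ∑ l, w l ^ 2 ≤ 1 →
        ∑ x, (4 * (rademacherSum w x - truncate R (rademacherSum w x)) / c) ^ 2 ≤ 1 :=
      fun w hw => by
        simp only [div_pow, ← Finset.sum_div]
        rw [div_le_one (by positivity), hc2]
        have h4 := sum_rademacherSum_pow_four_le w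
        have h3 : (∑ l, w l ^ 2) ^ 2 ≤ 1 :=
          pow_le_one₀ (Finset.sum_nonneg fun _ _ => sq_nonneg _) hw
        have : ∑ x, (4 * (rademacherSum w x - truncate R (rademacherSum w x))) ^ 2
            ≤ (1 / 3) * ∑ x, rademacherSum w x ^ 4 := by
          rw [Finset.mul_sum]
          refine Finset.sum_le_sum fun x _ => ?_
          have := sub_truncate_sq_le hR (rademacherSum w x)
          rw [hR2] at this
          linarith
        have h2 : (0 : ℝ) < 2 ^ m := by positivity
        nlinarith
    let X : ι → (Fin m → Bool) → ℝ := fun i => rademacherSum (u i)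
    let Y : ι → (Fin m → Bool) → ℝ := fun i => rademacherSum (v i)
    have h1 := ih' (fun i x => 4 * (X i x - truncate R (X i x)) / c)
      (fun j x => truncate R (Y j x) / c) (fun i => hrest _ (hu i)) (fun i => htrunc _ (hv i))
    have h2 := ih' (fun i x => X i x / c)
      (fun j x => 4 * (Y j x - truncate R (Y j x)) / c) (fun i => hfull _ (hu i))
      (fun i => hrest _ (hv i))
    have h3 : ∑ i, ∑ j, M i j * ∑ x, truncate R (X i x) * truncate R (Y j x) / c ^ 2
        ≤ 48 * T := by
      calc _ = ∑ x, (∑ i, ∑ j, M i j * (truncate R (X i x) * truncate R (Y j x))) / c ^ 2 := by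
            simp only [Finset.mul_sum, Finset.sum_div]
            rw [Finset.sum_comm]
            conv_rhs => rw [Finset.sum_comm]
            rw [Finset.sum_comm]
            refine Finset.sum_congr rfl fun i _ => ?_
            rw [Finset.sum_comm]
            exact Finset.sum_congr rfl fun x _ => Finset.sum_congr rfl fun j _ => by ring
        _ ≤ ∑ x : Fin m → Bool, 48 * T / c ^ 2 := by
            refine Finset.sum_le_sum fun x _ => div_le_div_of_nonneg_right ?_ (sq_nonneg c)
            rw [← hR2]
            exact sum_mul_le_of_signBound h (fun i => abs_truncate_le hR _)
              fun i => abs_truncate_le hR _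
        _ = 48 * T := by
            rw [Finset.sum_const, hc2]
            simp
            field_simp
    have hsplit : ∑ i, ∑ j, M i j * ∑ l, u i l * v j l
        = ∑ i, ∑ j, M i j * ∑ x, truncate R (X i x) * truncate R (Y j x) / c ^ 2
          + (1 / 4) * (∑ i, ∑ j, M i j * ∑ x, 4 * (X i x - truncate R (X i x)) / c *
              (truncate R (Y j x) / c))
          + (1 / 4) * (∑ i, ∑ j, M i j * ∑ x, X i x / c *
              (4 * (Y j x - truncate R (Y j x)) / c)) := by
      simp only [Finset.mul_sum (Finset.univ : Finset ι), ← Finset.sum_add_distrib]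
      refine Finset.sum_congr rfl fun i _ => Finset.sum_congr rfl fun j _ => ?_
      rw [mul_left_comm (1 / 4), mul_left_comm (1 / 4), ← mul_add, ← mul_add, havg,
        Finset.mul_sum, Finset.mul_sum, Finset.sum_div, ← Finset.sum_add_distrib,
        ← Finset.sum_add_distrib]
      congr 1
      refine Finset.sum_congr rfl fun x _ => ?_
      simp only [X, Y]
      field_simp
      ring
    rw [hsplit, pow_succ _ k]
    linarith

/-- **Grothendieck's inequality** for Gram matrices of vectors in the unit ball, with the
constant `96`. -/
theorem grothendieck
    (h : ∀ x y : ι → Bool, ∑ i, ∑ j, M i j * (boolSign (x i) * boolSign (y j)) ≤ T) (m : ℕ)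
    (u v : ι → Fin m → ℝ) (hu : ∀ i, ∑ l, u i l ^ 2 ≤ 1) (hv : ∀ i, ∑ l, v i l ^ 2 ≤ 1) :
    ∑ i, ∑ j, M i j * ∑ l, u i l * v j l ≤ 96 * T := by
  have ht : Filter.Tendsto (fun k : ℕ => 96 * T + (1 / 2 : ℝ) ^ k * ∑ i, ∑ j, |M i j|)
      Filter.atTop (nhds (96 * T + 0 * ∑ i, ∑ j, |M i j|)) :=
    ((tendsto_pow_atTop_nhds_zero_of_lt_one (by norm_num) (by norm_num)).mul_const _).const_add _
  rw [zero_mul, add_zero] at ht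
  exact ge_of_tendsto' ht fun k => sum_mul_sum_le_aux h k m u v hu hv

end Grothendieck

open scoped MatrixOrder Matrix.Norms.L2Operator in
/-- Grothendieck's inequality for positive semidefinite matrices with unit diagonal. -/
theorem Matrix.PosSemidef.sum_mul_le {n : ℕ} {M : Fin n → Fin n → ℝ} {T : ℝ}
    (h : ∀ x y : Fin n → Bool, ∑ i, ∑ j, M i j * (boolSign (x i) * boolSign (y j)) ≤ T)
    {Y : Matrix (Fin n) (Fin n) ℝ} (hY : Y.PosSemidef) (hd : ∀ i, Y i i = 1) :
    ∑ i, ∑ j, M i j * Y i j ≤ 96 * T := by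
  -- The columns of B are Gram vectors of Y, of unit length because of the diagonal.
  obtain ⟨B, rfl⟩ : ∃ B : Matrix (Fin n) (Fin n) ℝ, Y = B.conjTranspose * B :=
    CStarAlgebra.nonneg_iff_eq_star_mul_self.1 hY.nonneg
  have hB : ∀ i j, (B.conjTranspose * B) i j = ∑ l, B l i * B l j := fun i j => by
    simp [Matrix.mul_apply]
  simp only [hB] at hd ⊢
  have hu : ∀ i, ∑ l, B l i ^ 2 ≤ 1 := fun i => by
    rw [← hd i]
    exact le_of_eq (Finset.sum_congr rfl fun l _ => by ring)
  exact grothendieck h n (fun i l => B l i) (fun i l => B l i) hu hu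

/-! ### Deterministic error bound. -/

namespace DCSBM

variable {n r : ℕ} {M : DCSBM n r} {p q g : ℝ}

/-- The matrix of edge probabilities, with zero diagonal. -/
def edgeProb (M : DCSBM n r) (i j : Fin n) : ℝ :=
  if i = j then 0 else M.θ i * M.θ j * M.B (M.cluster i) (M.cluster j)

theorem edgeProb_nonneg (M : DCSBM n r) (i j : Fin n) : 0 ≤ M.edgeProb i j := by
  unfold edgeProb
  split_ifs
  · exact le_rfl
  · exact mul_nonneg (mul_nonneg (M.θ_nonneg i) (M.θ_nonneg j)) (M.B_nonneg _ _)

theorem edgeProb_comm (M : DCSBM n r) (i j : Fin n) : M.edgeProb i j = M.edgeProb j i := by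
  unfold edgeProb
  rw [M.B_symm.apply, mul_comm (M.θ i)]
  simp only [eq_comm]

theorem IsFModel.B_eq (hM : M.IsFModel p q g) (a b : Fin r) :
    M.B a b = if a = b then p else q := by
  rcases lt_trichotomy a b with h | rfl | h
  · rw [if_neg h.ne, hM.offDiag a b h]
  · rw [if_pos rfl, hM.diag]
  · rw [if_neg h.ne', ← M.B_symm.apply, hM.offDiag b a h]

theorem IsFModel.sum_theta (hM : M.IsFModel p q g) : ∑ i, M.θ i = r * g := by
  rw [← Finset.sum_fiberwise Finset.univ M.cluster M.θ]
  have : ∀ a, ∑ i with M.cluster i = a, M.θ i = g := hM.weight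
  simp [this]

theorem IsFModel.sum_theta_mul_B (hM : M.IsFModel p q g) (a : Fin r) :
    ∑ j, M.θ j * M.B a (M.cluster j) = g * (p + ((r : ℝ) - 1) * q) := by
  have h : ∀ j, M.θ j * M.B a (M.cluster j)
      = (p - q) * (if M.cluster j = a then M.θ j else 0) + q * M.θ j := fun j => by
    rw [hM.B_eq]
    by_cases h : M.cluster j = a
    · rw [if_pos h.symm, if_pos h]; ring
    · rw [if_neg (Ne.symm h), if_neg h]; ring
  have hw : ∑ j with M.cluster j = a, M.θ j = g := hM.weight a
  simp only [h]
  rw [Finset.sum_add_distrib, ← Finset.mul_sum, ← Finset.mul_sum, hM.sum_theta,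
    ← Finset.sum_filter, hw]
  ring

theorem IsFModel.sum_edgeProb (hM : M.IsFModel p q g) (i : Fin n) :
    ∑ j, M.edgeProb i j = M.θ i * (g * (p + ((r : ℝ) - 1) * q)) - p * M.θ i ^ 2 := by
  have h : ∀ j, M.edgeProb i j = M.θ i * (M.θ j * M.B (M.cluster i) (M.cluster j))
      - if i = j then p * M.θ i ^ 2 else 0 := fun j => by
    unfold edgeProb
    by_cases h : i = j
    · subst h; rw [if_pos rfl, if_pos rfl, hM.diag]; ring
    · rw [if_neg h, if_neg h]; ring
  simp only [h]
  rw [Finset.sum_sub_distrib, ← Finset.mul_sum, hM.sum_theta_mul_B]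
  simp

theorem trueY_posSemidef (M : DCSBM n r) : M.trueY.PosSemidef := by
  have : M.trueY = (Matrix.of fun (a : Fin r) i => if M.cluster i = a then (1 : ℝ) else 0).conjTranspose
      * Matrix.of fun (a : Fin r) i => if M.cluster i = a then (1 : ℝ) else 0 := by
    ext i j
    simp [trueY, Matrix.mul_apply, eq_comm]
  rw [this]
  exact Matrix.posSemidef_conjTranspose_mul_self _

theorem trueY_mem_feasible (M : DCSBM n r) : M.trueY ∈ CMM.feasible n := by
  refine ⟨M.trueY_posSemidef, fun i j => ?_, fun i => by simp [trueY]⟩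
  unfold trueY
  rw [Matrix.of_apply]
  split_ifs <;> norm_num

theorem IsFModel.gap_le (hM : M.IsFModel p q g) {δ μ : ℝ} (hq : q + δ ≤ μ) (hp : μ ≤ p - δ)
    {Y : Matrix (Fin n) (Fin n) ℝ} (hY : Y ∈ CMM.feasible n) (i j : Fin n) :
    δ * |M.θ i * (M.trueY - Y) i j * M.θ j| ≤
      (M.trueY i j - Y i j) * (M.θ i * M.θ j * (M.B (M.cluster i) (M.cluster j) - μ)) := by
  obtain ⟨h0, h1⟩ := hY.2.1 i j
  rw [hM.B_eq, abs_mul, abs_mul, abs_of_nonneg (M.θ_nonneg i), abs_of_nonneg (M.θ_nonneg j),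
    Matrix.sub_apply]
  have hθ := mul_nonneg (M.θ_nonneg i) (M.θ_nonneg j)
  simp only [trueY, Matrix.of_apply]
  split_ifs
  · rw [abs_of_nonneg (by linarith)]
    have := mul_nonneg (mul_nonneg hθ (by linarith : 0 ≤ 1 - Y i j)) (by linarith : 0 ≤ p - μ - δ)
    linarith
  · rw [zero_sub, abs_neg, abs_of_nonneg h0]
    have := mul_nonneg (mul_nonneg hθ h0) (by linarith : 0 ≤ μ - q - δ)
    linarith

/-- If the adjacency matrix is close to its mean as a bilinear form on sign vectors, and the degrees
are close to their approximate means in `ℓ¹`, then every solution of the convex relaxation is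
close to the true partition matrix. -/
theorem IsFModel.weightedNorm_le (hM : M.IsFModel p q g) {δ lam κ T D : ℝ} (hlam : 0 ≤ lam)
    (hκ : 0 ≤ κ) (hq : q + δ ≤ lam * κ ^ 2) (hp : lam * κ ^ 2 ≤ p - δ) {G : SimpleGraph (Fin n)}
    (hT : ∀ x y : Fin n → Bool,
      ∑ i, ∑ j, (CMM.adj G i j - M.edgeProb i j) * (boolSign (x i) * boolSign (y j)) ≤ T)
    (hD : ∑ i, |CMM.deg G i - M.θ i * κ| ≤ D) {Y : Matrix (Fin n) (Fin n) ℝ}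
    (hY : CMM.IsSolution G lam Y) :
    δ * M.weightedNorm (M.trueY - Y) ≤ 192 * T + lam * (2 * (∑ i, M.θ i * κ) * D + D ^ 2) := by
  have hf : ∀ i, 0 ≤ M.θ i * κ := fun i => mul_nonneg (M.θ_nonneg i) hκ
  have hYf := hY.1
  have hopt := hY.2 _ M.trueY_mem_feasible
  have hT' : ∀ x y : Fin n → Bool, ∑ i, ∑ j, -(CMM.adj G i j - M.edgeProb i j) *
      (boolSign (x i) * boolSign (y j)) ≤ T := fun x y => by
    -- The sign bound is two-sided, by flipping x. Applying it to Y and Y* gives 2 · 96 = 192.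
    refine le_of_eq_of_le ?_ (hT (fun i => !x i) y)
    refine Finset.sum_congr rfl fun i _ => Finset.sum_congr rfl fun j _ => ?_
    have : boolSign (!x i) = -boolSign (x i) := by cases x i <;> simp [boolSign]
    rw [this]; ring
  have hG1 := hYf.1.sum_mul_le hT hYf.2.2
  have hG2 := M.trueY_posSemidef.sum_mul_le hT' M.trueY_mem_feasible.2.2
  set e : Fin n → ℝ := fun i => |CMM.deg G i - M.θ i * κ|
  have hpt : ∀ i j, δ * |M.θ i * (M.trueY - Y) i j * M.θ j| ≤
      (M.trueY i j * (CMM.adj G i j - lam * (CMM.deg G i * CMM.deg G j))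
        - Y i j * (CMM.adj G i j - lam * (CMM.deg G i * CMM.deg G j)))
      + ((CMM.adj G i j - M.edgeProb i j) * Y i j
        + -(CMM.adj G i j - M.edgeProb i j) * M.trueY i j)
      + lam * (M.θ i * κ * e j + e i * (M.θ j * κ) + e i * e j) := fun i j => by
    have h1 := hM.gap_le hq hp hYf i j
    have h2 : (M.trueY i j - Y i j) * (M.θ i * M.θ j * M.B (M.cluster i) (M.cluster j))
        = (M.trueY i j - Y i j) * M.edgeProb i j := by
      unfold edgeProb
      split_ifs with h
      -- The diagonal of the mean matrix is immaterial, since both matrices have unit diagonal.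
      · subst h
        rw [hYf.2.2, M.trueY_mem_feasible.2.2]; ring
      · rfl
    have h3 : (M.trueY i j - Y i j) * (CMM.deg G i * CMM.deg G j - M.θ i * κ * (M.θ j * κ))
        ≤ M.θ i * κ * e j + e i * (M.θ j * κ) + e i * e j := by
      have hZ : |M.trueY i j - Y i j| ≤ 1 := by
        have := hYf.2.1 i j
        have := M.trueY_mem_feasible.2.1 i j
        exact abs_le.2 ⟨by linarith, by linarith⟩
      refine (le_abs_self _).trans ?_
      rw [abs_mul]
      refine (mul_le_of_le_one_left (abs_nonneg _) hZ).trans ?_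
      have : CMM.deg G i * CMM.deg G j - M.θ i * κ * (M.θ j * κ)
          = M.θ i * κ * (CMM.deg G j - M.θ j * κ) + (CMM.deg G i - M.θ i * κ) * (M.θ j * κ)
            + (CMM.deg G i - M.θ i * κ) * (CMM.deg G j - M.θ j * κ) := by ring
      rw [this]
      refine (abs_add_le _ _).trans (add_le_add ((abs_add_le _ _).trans (add_le_add ?_ ?_)) ?_)
      · rw [abs_mul, abs_of_nonneg (hf i)]
      · rw [abs_mul, abs_of_nonneg (hf j)]
      · rw [abs_mul]
    have h4 := mul_le_mul_of_nonneg_left h3 hlam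
    linarith
  have hsum := Finset.sum_le_sum fun i (_ : i ∈ Finset.univ) =>
    Finset.sum_le_sum fun j (_ : j ∈ Finset.univ) => hpt i j
  have hcross : ∑ i, ∑ j, lam * (M.θ i * κ * e j + e i * (M.θ j * κ) + e i * e j)
      = lam * (2 * (∑ i, M.θ i * κ) * (∑ i, e i) + (∑ i, e i) ^ 2) := by
    simp only [← Finset.mul_sum, Finset.sum_add_distrib, ← Finset.sum_mul]
    ring
  simp only [Finset.sum_add_distrib, Finset.sum_sub_distrib, ← Finset.mul_sum] at hsum hcross
  rw [hcross] at hsum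
  unfold CMM.objective at hopt
  have he0 : 0 ≤ ∑ i, e i := Finset.sum_nonneg fun i _ => abs_nonneg _
  have hF0 : 0 ≤ ∑ i, M.θ i * κ := Finset.sum_nonneg fun i _ => hf i
  have hfin : lam * (2 * (∑ i, M.θ i * κ) * (∑ i, e i) + (∑ i, e i) ^ 2)
      ≤ lam * (2 * (∑ i, M.θ i * κ) * D + D ^ 2) := by gcongr
  unfold weightedNorm
  linarith

end DCSBM

/-! ### Weighted sums of independent centered indicators. -/

section WeightedCount

variable {Ω E : Type*} [MeasurableSpace Ω] {P : Measure Ω} {S : E → Set Ω}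

theorem iIndepFun_centered (hind : iIndepSet S P) (c : E → ℝ) :
    iIndepFun (fun e ω => c e * ((S e).indicator (fun _ => 1) ω - P.real (S e))) P :=
  hind.iIndepFun_indicator.comp (fun e t => c e * (t - P.real (S e)))
    fun _ => (measurable_id.sub_const _).const_mul _

theorem integral_indicator_comp [IsProbabilityMeasure P] {A : Set Ω} (hA : MeasurableSet A)
    (F : ℝ → ℝ) :
    ∫ ω, F (A.indicator (fun _ => 1) ω) ∂P = P.real A * F 1 + (1 - P.real A) * F 0 := by
  have h : ∀ ω, F (A.indicator (fun _ => 1) ω)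
      = A.indicator (fun _ => F 1 - F 0) ω + F 0 := fun ω => by
    by_cases h : ω ∈ A <;> simp [h]
  simp only [h]
  rw [integral_add ((integrable_const _).indicator hA) (integrable_const _),
    integral_indicator_const _ hA]
  simp
  ring

variable [Fintype E]

/-- The centered number of events that occur, with weights `c`. -/
noncomputable def centeredCount (P : Measure Ω) (S : E → Set Ω) (c : E → ℝ) (ω : Ω) : ℝ :=
  ∑ e, c e * ((S e).indicator (fun _ => 1) ω - P.real (S e))

theorem measurable_centeredCount (hS : ∀ e, MeasurableSet (S e)) (c : E → ℝ) :
    Measurable (centeredCount P S c) := by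
  unfold centeredCount
  exact Finset.measurable_sum _ fun e _ =>
    ((measurable_const.indicator (hS e)).sub_const _).const_mul _

variable [IsProbabilityMeasure P]

theorem abs_centeredCount_le (c : E → ℝ) (ω : Ω) : |centeredCount P S c ω| ≤ ∑ e, |c e| := by
  refine (Finset.abs_sum_le_sum_abs _ _).trans (Finset.sum_le_sum fun e _ => ?_)
  rw [abs_mul]
  refine mul_le_of_le_one_right (abs_nonneg _) ?_
  have h0 : 0 ≤ P.real (S e) := measureReal_nonneg
  have h1 : P.real (S e) ≤ 1 := measureReal_le_one
  by_cases h : ω ∈ S e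
  · rw [Set.indicator_of_mem h, abs_le]; constructor <;> linarith
  · rw [Set.indicator_of_notMem h, abs_le]; constructor <;> linarith

/-- With x = s c_e and π the probability of the event, e^x ≤ 1 + x + x² for |x| ≤ 1 gives 1 + π(e^x
- 1) ≤ exp(π(x + x²)); centering cancels the linear term. -/
theorem mgf_centeredCount_le (hS : ∀ e, MeasurableSet (S e)) (hind : iIndepSet S P) {c : E → ℝ}
    {s : ℝ} (hs : ∀ e, |s * c e| ≤ 1) :
    mgf (centeredCount P S c) P s ≤ Real.exp (∑ e, P.real (S e) * (s * c e) ^ 2) := by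
  have h : centeredCount P S c
      = ∑ e, fun ω => c e * ((S e).indicator (fun _ => 1) ω - P.real (S e)) := by
    ext ω; simp [centeredCount]
  rw [h, (iIndepFun_centered hind c).mgf_sum
    fun e => ((measurable_const.indicator (hS e)).sub_const _).const_mul _, Real.exp_sum]
  refine Finset.prod_le_prod (fun e _ => mgf_nonneg) fun e _ => ?_
  have h0 : 0 ≤ P.real (S e) := measureReal_nonneg
  have := integral_indicator_comp (P := P) (hS e)
    fun t => Real.exp (s * (c e * (t - P.real (S e))))
  unfold mgf
  rw [this]
  have hb := abs_le.1 (Real.abs_exp_sub_one_sub_id_le (hs e))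
  set π := P.real (S e)
  have e1 : Real.exp (s * (c e * (1 - π))) = Real.exp (s * c e) * Real.exp (-(s * c e * π)) := by
    rw [← Real.exp_add]; ring_nf
  have e0 : Real.exp (s * (c e * (0 - π))) = Real.exp (-(s * c e * π)) := by ring_nf
  rw [e1, e0]
  calc _ = (π * (Real.exp (s * c e) - 1) + 1) * Real.exp (-(s * c e * π)) := by ring
    _ ≤ Real.exp (π * (s * c e + (s * c e) ^ 2)) * Real.exp (-(s * c e * π)) := by
        refine mul_le_mul_of_nonneg_right ?_ (Real.exp_pos _).le
        refine le_trans ?_ (Real.add_one_le_exp _)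
        gcongr
        linarith [hb.2]
    _ = _ := by rw [← Real.exp_add]; ring_nf

/-- A Bernstein-type bound for the upper tail of a weighted count of independent events. -/
theorem measure_centeredCount_ge_le (hS : ∀ e, MeasurableSet (S e)) (hind : iIndepSet S P)
    {c : E → ℝ} (hc : ∀ e, |c e| ≤ 2) {N v : ℝ} (hN : 0 ≤ N) (hv : ∑ e, P.real (S e) ≤ v) :
    P.real {ω | 8 * N + √(32 * N * v) ≤ centeredCount P S c ω} ≤ Real.exp (-(2 * N)) := by
  have hv0 : 0 ≤ v := (Finset.sum_nonneg fun e _ => measureReal_nonneg).trans hv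
  obtain ⟨s, hs0, hs1, hs⟩ : ∃ s : ℝ, 0 ≤ s ∧ s ≤ 1 / 2 ∧
      4 * s ^ 2 * v - s * (8 * N + √(32 * N * v)) ≤ -(2 * N) := by
    -- The ideal choice is s = √(N/(2v)), capped at 1/2 so that |s c_e| ≤ 1.
    rcases le_total v (2 * N) with h | h
    · refine ⟨1 / 2, by norm_num, le_rfl, ?_⟩
      have := Real.sqrt_nonneg (32 * N * v)
      linarith
    · rcases hv0.eq_or_lt with h0 | h0
      · refine ⟨0, le_rfl, by norm_num, ?_⟩
        linarith
      have hsq : √(N / (2 * v)) ^ 2 = N / (2 * v) := Real.sq_sqrt (by positivity)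
      refine ⟨√(N / (2 * v)), Real.sqrt_nonneg _, ?_, ?_⟩
      · refine Real.sqrt_le_iff.2 ⟨by norm_num, ?_⟩
        rw [div_le_iff₀ (by positivity)]
        linarith
      · have h1 : √(N / (2 * v)) * √(32 * N * v) = 4 * N := by
          rw [← Real.sqrt_mul (by positivity), ← Real.sqrt_sq (by positivity : 0 ≤ 4 * N)]
          congr 1
          field_simp
          ring
        have h2 : 0 ≤ √(N / (2 * v)) * (8 * N) := by positivity
        have h3 : 4 * (N / (2 * v)) * v = 2 * N := by field_simp; ring
        rw [mul_add, h1, hsq, h3]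
        linarith
  have hint : Integrable (fun ω => Real.exp (s * centeredCount P S c ω)) P := by
    refine Integrable.of_bound
      (((measurable_centeredCount hS c).const_mul s).exp.aestronglyMeasurable)
      (Real.exp (s * ∑ e, |c e|)) (ae_of_all _ fun ω => ?_)
    rw [Real.norm_eq_abs, Real.abs_exp, Real.exp_le_exp]
    exact mul_le_mul_of_nonneg_left ((le_abs_self _).trans (abs_centeredCount_le c ω)) hs0
  refine (measure_ge_le_exp_mul_mgf _ hs0 hint).trans ?_
  have hsc : ∀ e, |s * c e| ≤ 1 := fun e => by
    rw [abs_mul, abs_of_nonneg hs0]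
    nlinarith [hc e, abs_nonneg (c e)]
  refine (mul_le_mul_of_nonneg_left (mgf_centeredCount_le hS hind hsc) (Real.exp_pos _).le).trans ?_
  rw [← Real.exp_add, Real.exp_le_exp]
  have : ∑ e, P.real (S e) * (s * c e) ^ 2 ≤ 4 * s ^ 2 * v := by
    refine le_trans ?_ (mul_le_mul_of_nonneg_left hv (by positivity))
    rw [Finset.mul_sum]
    refine Finset.sum_le_sum fun e _ => ?_
    have h4 : c e ^ 2 ≤ 4 := by
      rw [← sq_abs]; nlinarith [hc e, abs_nonneg (c e)]
    have h0 : 0 ≤ P.real (S e) * s ^ 2 := mul_nonneg measureReal_nonneg (sq_nonneg _)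
    nlinarith
  linarith

theorem memLp_centeredCount (hS : ∀ e, MeasurableSet (S e)) (c : E → ℝ) :
    MemLp (centeredCount P S c) 2 P :=
  MemLp.of_bound (measurable_centeredCount hS c).aestronglyMeasurable _
    (ae_of_all _ fun ω => abs_centeredCount_le c ω)

/-- Independence makes the variance additive, and each summand has variance at most c²π. -/
theorem integral_centeredCount_sq_le (hS : ∀ e, MeasurableSet (S e)) (hind : iIndepSet S P)
    (c : E → ℝ) : ∫ ω, centeredCount P S c ω ^ 2 ∂P ≤ ∑ e, c e ^ 2 * P.real (S e) := by
  have hmeas : ∀ e, Measurable fun ω => c e * ((S e).indicator (fun _ => 1) ω - P.real (S e)) :=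
    fun e => ((measurable_const.indicator (hS e)).sub_const _).const_mul _
  have hmem : ∀ e, MemLp (fun ω => c e * ((S e).indicator (fun _ => 1) ω - P.real (S e))) 2 P :=
    fun e => by
      have := memLp_centeredCount (P := P) (S := fun _ : Unit => S e) (fun _ => hS e) fun _ => c e
      refine this.ae_eq (ae_of_all _ fun ω => ?_)
      simp [centeredCount]
  have h : centeredCount P S c
      = ∑ e, fun ω => c e * ((S e).indicator (fun _ => 1) ω - P.real (S e)) := by
    ext ω; simp [centeredCount]
  have hzero : ∀ e, ∫ ω, c e * ((S e).indicator (fun _ => 1) ω - P.real (S e)) ∂P = 0 :=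
    fun e => by
      rw [integral_indicator_comp (hS e) fun t => c e * (t - P.real (S e))]
      ring
  have hmean : ∫ ω, centeredCount P S c ω ∂P = 0 := by
    unfold centeredCount
    rw [integral_finsetSum _ fun e _ => (hmem e).integrable (by norm_num)]
    exact Finset.sum_eq_zero fun e _ => hzero e
  have hvar := variance_eq_sub (memLp_centeredCount (P := P) hS c)
  rw [hmean] at hvar
  have hvs : variance (centeredCount P S c) P
      = ∑ e, variance (fun ω => c e * ((S e).indicator (fun _ => 1) ω - P.real (S e))) P := by
    rw [h]
    exact IndepFun.variance_sum (fun e _ => hmem e)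
      fun i _ j _ hij => (iIndepFun_centered hind c).indepFun hij
  have heq : ∫ ω, centeredCount P S c ω ^ 2 ∂P = variance (centeredCount P S c) P := by
    rw [hvar]; simp
  rw [heq, hvs]
  refine Finset.sum_le_sum fun e _ => ?_
  refine (variance_le_expectation_sq (hmeas e).aestronglyMeasurable).trans ?_
  have := integral_indicator_comp (P := P) (hS e) fun t => (c e * (t - P.real (S e))) ^ 2
  simp only [Pi.pow_apply]
  rw [this]
  have h0 : 0 ≤ (c e * P.real (S e)) ^ 2 := sq_nonneg _
  nlinarith

theorem integral_abs_centeredCount_le (hS : ∀ e, MeasurableSet (S e)) (hind : iIndepSet S P)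
    (c : E → ℝ) : ∫ ω, |centeredCount P S c ω| ∂P ≤ √(∑ e, c e ^ 2 * P.real (S e)) := by
  refine Real.le_sqrt_of_sq_le ((?_ : _ ≤ _).trans (integral_centeredCount_sq_le hS hind c))
  have h := variance_nonneg (fun ω => |centeredCount P S c ω|) P
  rw [variance_eq_sub (X := fun ω => |centeredCount P S c ω|) (memLp_centeredCount hS c).abs] at h
  simp only [Pi.pow_apply, sq_abs] at h
  linarith

end WeightedCount

/-! ### Concentration of the adjacency matrix and of the degrees. -/

/-- Passes from ordered pairs to unordered ones, over which the edges are independent. -/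
theorem sum_sum_eq_sum_lt {n : ℕ} {f : Fin n → Fin n → ℝ} (h : ∀ i, f i i = 0) :
    ∑ i, ∑ j, f i j
      = ∑ e : {e : Fin n × Fin n // e.1 < e.2}, (f e.1.1 e.1.2 + f e.1.2 e.1.1) := by
  rw [← Finset.sum_subtype (Finset.univ.filter fun e : Fin n × Fin n => e.1 < e.2) (by simp)
    fun e => f e.1 e.2 + f e.2 e.1, Finset.sum_add_distrib, ← Fintype.sum_prod_type',
    ← Finset.sum_filter_add_sum_filter_not Finset.univ fun e : Fin n × Fin n => e.1 < e.2]
  congr 1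
  rw [Finset.sum_filter, Finset.sum_filter, ← (Equiv.prodComm (Fin n) (Fin n)).sum_comp]
  refine Finset.sum_congr rfl fun e _ => ?_
  rcases lt_trichotomy e.1 e.2 with h' | h' | h'
  · simp [h', h'.le]
  · simp [h', h]
  · simp [h', h'.le]

namespace DCSBM

variable {n r : ℕ} {M : DCSBM n r} {p q g : ℝ} {Ω : Type*} [MeasurableSpace Ω] {P : Measure Ω}
  {G : Ω → SimpleGraph (Fin n)}

/-- The event that the edge `e` is present. -/
def edgeEvent (G : Ω → SimpleGraph (Fin n)) (e : {e : Fin n × Fin n // e.1 < e.2}) : Set Ω :=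
  {ω | (G ω).Adj e.1.1 e.1.2}

theorem IsRandomGraph.measureReal_edgeEvent (hG : M.IsRandomGraph P G)
    (e : {e : Fin n × Fin n // e.1 < e.2}) :
    P.real (edgeEvent G e) = M.edgeProb e.1.1 e.1.2 := by
  rw [edgeEvent, hG.prob_adj _ _ e.2.ne, edgeProb, if_neg e.2.ne]

theorem IsRandomGraph.sum_mul_eq_centeredCount (hG : M.IsRandomGraph P G)
    (w : Fin n → Fin n → ℝ) (ω : Ω) :
    ∑ i, ∑ j, (CMM.adj (G ω) i j - M.edgeProb i j) * w i j
      = centeredCount P (edgeEvent G) (fun e => w e.1.1 e.1.2 + w e.1.2 e.1.1) ω := by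
  rw [sum_sum_eq_sum_lt fun i => by simp [CMM.adj, edgeProb]]
  refine Finset.sum_congr rfl fun e _ => ?_
  have h : (edgeEvent G e).indicator (fun _ => (1 : ℝ)) ω = CMM.adj (G ω) e.1.1 e.1.2 := by
    by_cases ha : (G ω).Adj e.1.1 e.1.2
    · rw [Set.indicator_of_mem (show ω ∈ edgeEvent G e from ha)]; simp [CMM.adj, ha]
    · rw [Set.indicator_of_notMem (show ω ∉ edgeEvent G e from ha)]; simp [CMM.adj, ha]
  have h' : CMM.adj (G ω) e.1.2 e.1.1 = CMM.adj (G ω) e.1.1 e.1.2 := by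
    classical exact (SimpleGraph.isSymm_adjMatrix (G ω)).apply _ _
  rw [h, h', hG.measureReal_edgeEvent, M.edgeProb_comm e.1.2]
  ring

theorem IsRandomGraph.sum_mul_measureReal_edgeEvent (hG : M.IsRandomGraph P G)
    (w : Fin n → Fin n → ℝ) :
    ∑ e, (w e.1.1 e.1.2 + w e.1.2 e.1.1) * P.real (edgeEvent G e)
      = ∑ i, ∑ j, w i j * M.edgeProb i j := by
  rw [sum_sum_eq_sum_lt fun i => by simp [edgeProb]]
  refine Finset.sum_congr rfl fun e _ => ?_
  rw [hG.measureReal_edgeEvent, M.edgeProb_comm e.1.2]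
  ring

variable [IsProbabilityMeasure P]

/-- Concentration of the adjacency matrix as a bilinear form on sign vectors. -/
theorem IsRandomGraph.measure_signForm_gt_le (hG : M.IsRandomGraph P G) {v : ℝ}
    (hv : ∑ i, ∑ j, M.edgeProb i j ≤ 2 * v) :
    P.real {ω | ¬ ∀ x y : Fin n → Bool, ∑ i, ∑ j, (CMM.adj (G ω) i j - M.edgeProb i j) *
      (boolSign (x i) * boolSign (y j)) ≤ 8 * n + √(32 * n * v)}
      ≤ (Real.exp 1 / 2) ^ (-(2 * (n : ℝ))) := by
  have hsub : {ω | ¬ ∀ x y : Fin n → Bool, ∑ i, ∑ j, (CMM.adj (G ω) i j - M.edgeProb i j) *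
      (boolSign (x i) * boolSign (y j)) ≤ 8 * n + √(32 * n * v)}
      ⊆ ⋃ z : (Fin n → Bool) × (Fin n → Bool), {ω | 8 * (n : ℝ) + √(32 * n * v) ≤
        centeredCount P (edgeEvent G) (fun e => boolSign (z.1 e.1.1) * boolSign (z.2 e.1.2)
          + boolSign (z.1 e.1.2) * boolSign (z.2 e.1.1)) ω} := fun ω hω => by
    simp only [Set.mem_ofPred_eq, not_forall, not_le] at hω
    obtain ⟨x, y, hxy⟩ := hω
    rw [hG.sum_mul_eq_centeredCount fun i j => boolSign (x i) * boolSign (y j)] at hxy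
    exact Set.mem_iUnion.2 ⟨(x, y), hxy.le⟩
  have hv' : ∑ e, P.real (edgeEvent G e) ≤ v := by
    have := hG.sum_mul_measureReal_edgeEvent fun _ _ => 1
    simp only [one_mul, ← Finset.mul_sum] at this
    linarith
  have habs : ∀ b, |boolSign b| = 1 := fun b => by cases b <;> simp [boolSign]
  refine (measureReal_mono hsub).trans ((measureReal_iUnion_fintype_le _).trans ?_)
  refine (Finset.sum_le_sum fun z _ => measure_centeredCount_ge_le
    (fun e => hG.measurableSet_adj _ _) hG.indep (fun e => ?_) n.cast_nonneg hv').trans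
    (le_of_eq ?_)
  · refine (abs_add_le _ _).trans ?_
    rw [abs_mul, abs_mul, habs, habs, habs, habs]
    norm_num
  -- The union over 4^n sign pairs, each of cost e^(-2n), gives (e/2)^(-2n).
  · have h2 : ((2 * n : ℕ) : ℝ) = 2 * (n : ℝ) := by push_cast; ring
    rw [Real.rpow_neg (by positivity), ← h2, Real.rpow_natCast, div_pow, inv_div,
      ← Real.exp_nat_mul, mul_one, Real.exp_neg]
    simp only [Finset.sum_const, Finset.card_univ, Fintype.card_prod, Fintype.card_fun,
      Fintype.card_bool, Fintype.card_fin, nsmul_eq_mul]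
    push_cast
    ring

theorem IsRandomGraph.integral_abs_deg_sub_le (hG : M.IsRandomGraph P G) (i : Fin n) :
    Integrable (fun ω => |CMM.deg (G ω) i - ∑ j, M.edgeProb i j|) P ∧
    ∫ ω, |CMM.deg (G ω) i - ∑ j, M.edgeProb i j| ∂P ≤ √(∑ j, M.edgeProb i j) := by
  let w : Fin n → Fin n → ℝ := fun k _ => if k = i then 1 else 0
  have hw : ∀ f : Fin n → Fin n → ℝ, ∑ k, ∑ l, f k l * w k l = ∑ l, f i l := fun f => by
    simp [w, Finset.sum_ite_eq']
  let c : {e : Fin n × Fin n // e.1 < e.2} → ℝ := fun e => w e.1.1 e.1.2 + w e.1.2 e.1.1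
  have h : ∀ ω, CMM.deg (G ω) i - ∑ j, M.edgeProb i j
      = centeredCount P (edgeEvent G) c ω := fun ω => by
    rw [← hG.sum_mul_eq_centeredCount w, hw, Finset.sum_sub_distrib]
    rfl
  have hmeas : ∀ e, MeasurableSet (edgeEvent G e) := fun e => hG.measurableSet_adj _ _
  simp only [h]
  refine ⟨((memLp_centeredCount hmeas c).integrable (by norm_num)).abs,
    (integral_abs_centeredCount_le hmeas hG.indep c).trans (Real.sqrt_le_sqrt (le_of_eq ?_))⟩
  have hp := hG.sum_mul_measureReal_edgeEvent w
  simp only [mul_comm (w _ _), hw] at hp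
  rw [← hp]
  refine Finset.sum_congr rfl fun e _ => ?_
  -- A pair of distinct nodes contains i at most once, so c is 0 or 1.
  have hc : c e ^ 2 = c e := by
    have := e.2.ne
    by_cases h1 : e.1.1 = i <;> by_cases h2 : e.1.2 = i
    · exact absurd (h1.trans h2.symm) this
    all_goals simp [c, w, h1, h2]
  rw [hc]

/-- The degrees are close to their means in `ℓ¹`, with probability at least `0.99`. -/
theorem IsRandomGraph.measure_sum_abs_deg_sub_ge_le (hG : M.IsRandomGraph P G) {s : ℝ}
    (hs : 0 < s) (h : n * ∑ i, ∑ j, M.edgeProb i j ≤ s ^ 2) :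
    P.real {ω | 100 * s ≤ ∑ i, |CMM.deg (G ω) i - ∑ j, M.edgeProb i j|} ≤ 0.01 := by
  have hint := fun i => (hG.integral_abs_deg_sub_le i).1
  have hm := mul_meas_ge_le_integral_of_nonneg
    (ae_of_all P fun ω => Finset.sum_nonneg fun i _ => abs_nonneg _)
    (integrable_finsetSum Finset.univ fun i _ => hint i) (100 * s)
  rw [integral_finsetSum _ fun i _ => hint i] at hm
  have hle : ∑ i, √(∑ j, M.edgeProb i j) ≤ s := by
    refine abs_le_of_sq_le_sq' ?_ hs.le |>.2
    refine sq_sum_le_card_mul_sum_sq.trans (le_of_eq_of_le ?_ h)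
    rw [Finset.card_univ, Fintype.card_fin]
    congr 1
    exact Finset.sum_congr rfl fun i _ =>
      Real.sq_sqrt (Finset.sum_nonneg fun j _ => M.edgeProb_nonneg i j)
  have h1 := (hm.trans (Finset.sum_le_sum fun i _ => (hG.integral_abs_deg_sub_le i).2)).trans hle
  have : s * (100 * P.real {ω | 100 * s ≤ ∑ i, |CMM.deg (G ω) i - ∑ j, M.edgeProb i j|})
      ≤ s * 1 := by linarith
  have := le_of_mul_le_mul_left this hs
  norm_num
  linarith

end DCSBM

/-! ### Assembly of the bounds. -/

namespace DCSBM

variable {n r : ℕ} {M : DCSBM n r} {p q g : ℝ}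

/-- Controls the diagonal correction to the mean degrees. The edge-probability constraint at i = j
gives p θ_i² ≤ 1, so after Cauchy–Schwarz squares can be dropped, and one factor θ_i is at most g.
-/
theorem IsFModel.sum_mul_theta_sq_sq_le (hM : M.IsFModel p q g) (hp : 0 ≤ p) :
    (∑ i, p * M.θ i ^ 2) ^ 2 ≤ n * (r * g * (g * p)) := by
  have hg : ∀ i, M.θ i ≤ g := fun i => by
    rw [← hM.weight (M.cluster i)]
    exact Finset.single_le_sum (f := M.θ) (fun j _ => M.θ_nonneg j) (by simp)
  have h1 : ∀ i, p * M.θ i ^ 2 ≤ 1 := fun i => by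
    have := M.edgeProb_le_one i i
    rw [hM.diag] at this
    linarith
  refine sq_sum_le_card_mul_sum_sq.trans ?_
  rw [Finset.card_univ, Fintype.card_fin, ← hM.sum_theta, Finset.sum_mul]
  refine mul_le_mul_of_nonneg_left (Finset.sum_le_sum fun i _ => ?_) n.cast_nonneg
  have h0 := M.θ_nonneg i
  calc (p * M.θ i ^ 2) ^ 2 ≤ p * M.θ i ^ 2 :=
        pow_le_of_le_one (by positivity) (h1 i) two_ne_zero
    _ = M.θ i * (M.θ i * p) := by ring
    _ ≤ M.θ i * (g * p) := by gcongr; exact hg i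

theorem IsFModel.sum_sum_edgeProb_le (hM : M.IsFModel p q g) (hp : 0 ≤ p) :
    ∑ i, ∑ j, M.edgeProb i j ≤ r * g * (g * (p + ((r : ℝ) - 1) * q)) := by
  rw [← hM.sum_theta, Finset.sum_mul]
  refine Finset.sum_le_sum fun i _ => ?_
  rw [hM.sum_edgeProb]
  have : 0 ≤ p * M.θ i ^ 2 := by positivity
  linarith

/-- Recovery of the true partition in the nondegenerate case. -/
theorem IsFModel.le_measure_weightedNorm_le (hM : M.IsFModel p q g) {δ lam : ℝ} (hn : 0 < n)
    (hr : 0 < r) (hq : 0 ≤ q) (hδ : 0 < δ) (hpq : 2 * δ < p - q)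
    (hl : (q + δ) / ((p + ((r : ℝ) - 1) * q) ^ 2 * g ^ 2) < lam)
    (hu : lam < (p - δ) / ((p + ((r : ℝ) - 1) * q) ^ 2 * g ^ 2))
    {Ω : Type*} [MeasurableSpace Ω] {P : Measure Ω} [IsProbabilityMeasure P]
    {G : Ω → SimpleGraph (Fin n)} (hG : M.IsRandomGraph P G) :
    0.99 - 2 * (Real.exp 1 / 2) ^ (-(2 * (n : ℝ))) ≤
      P.real {ω | ∀ Y : Matrix (Fin n) (Fin n) ℝ, CMM.IsSolution (G ω) lam Y →
        M.weightedNorm (M.trueY - Y) ≤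
          20000 * (1 / δ * (1 + r * p / (p + ((r : ℝ) - 1) * q)) * (n + r * g * √(n * p)))} := by
  have hr1 : (1 : ℝ) ≤ r := by exact_mod_cast hr
  have hp : 0 < p := by linarith
  set K : ℝ := p + ((r : ℝ) - 1) * q with hK
  have hpK : p ≤ K := by
    have := mul_nonneg (by linarith : 0 ≤ (r : ℝ) - 1) hq
    linarith
  have hKr : K ≤ r * p := by
    have := mul_nonneg (by linarith : 0 ≤ (r : ℝ) - 1) (by linarith : 0 ≤ p - q)
    linarith
  have hK0 : 0 < K := hp.trans_le hpK
  have hg : 0 < g := by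
    refine lt_of_le_of_ne ?_ fun h => ?_
    · rw [← hM.weight ⟨0, hr⟩]
      exact Finset.sum_nonneg fun i _ => M.θ_nonneg i
    -- If g = 0, division by zero makes both ends of the window 0, which leaves no λ.
    · rw [← h] at hl hu
      simp only [ne_eq, OfNat.ofNat_ne_zero, not_false_eq_true, zero_pow, mul_zero, div_zero]
        at hl hu
      exact lt_asymm hl hu
  rw [div_lt_iff₀ (by positivity)] at hl
  rw [lt_div_iff₀ (by positivity)] at hu
  set κ : ℝ := g * K with hκ
  have hκ2 : K ^ 2 * g ^ 2 = κ ^ 2 := by rw [hκ]; ring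
  rw [hκ2] at hl hu
  have hκ0 : 0 < κ := mul_pos hg hK0
  have hlam : 0 ≤ lam := by
    by_contra! h
    nlinarith [sq_nonneg κ]
  set s : ℝ := √(n * (r * g * κ)) with hs
  have hs2 : s ^ 2 = n * (r * g * κ) := Real.sq_sqrt (by positivity)
  have hs0 : 0 < s := Real.sqrt_pos.2 (by positivity)
  have hsle : s ≤ r * g * √(n * p) := by
    rw [hs, Real.sqrt_le_iff]
    refine ⟨by positivity, ?_⟩
    rw [mul_pow, Real.sq_sqrt (by positivity)]
    calc (n : ℝ) * (r * g * κ) ≤ n * (r * g * (g * (r * p))) := by rw [hκ]; gcongr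
      _ = _ := by ring
  have hE := hM.sum_sum_edgeProb_le hp.le
  rw [← hK, ← hκ] at hE
  have hA := hG.measure_signForm_gt_le (v := r * g * κ / 2) (by linarith)
  have hB := hG.measure_sum_abs_deg_sub_ge_le hs0 (by rw [hs2]; gcongr)
  have h4s : √(32 * n * (r * g * κ / 2)) = 4 * s := by
    rw [Real.sqrt_eq_iff_eq_sq (by positivity) (by positivity), mul_pow, hs2]
    ring
  rw [h4s] at hA
  have hdiag : ∑ i, p * M.θ i ^ 2 ≤ s := by
    refine (abs_le_of_sq_le_sq' ?_ hs0.le).2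
    rw [hs2]
    refine (hM.sum_mul_theta_sq_sq_le hp.le).trans ?_
    rw [hκ]
    gcongr
  -- Covering the whole space by the good event and two bad ones needs only subadditivity, so the
  -- good event need not be shown measurable.
  have hsub : Set.univ ⊆
      {ω | ∀ Y : Matrix (Fin n) (Fin n) ℝ, CMM.IsSolution (G ω) lam Y →
        M.weightedNorm (M.trueY - Y) ≤ 20000 * (1 / δ * (1 + r * p / K) * (n + r * g * √(n * p)))}
      ∪ ({ω | ¬ ∀ x y : Fin n → Bool, ∑ i, ∑ j, (CMM.adj (G ω) i j - M.edgeProb i j) *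
          (boolSign (x i) * boolSign (y j)) ≤ 8 * n + 4 * s}
        ∪ {ω | 100 * s ≤ ∑ i, |CMM.deg (G ω) i - ∑ j, M.edgeProb i j|}) := fun ω _ => by
    by_contra hω
    simp only [Set.mem_union, not_or, Set.mem_ofPred_eq, not_not, not_le] at hω
    obtain ⟨h1, h2, h3⟩ := hω
    refine h1 fun Y hY => ?_
    -- 100s comes from Markov's inequality and s from the diagonal correction.
    have hD : ∑ i, |CMM.deg (G ω) i - M.θ i * κ| ≤ 101 * s := by
      have : ∑ i, |CMM.deg (G ω) i - M.θ i * κ|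
          ≤ ∑ i, (|CMM.deg (G ω) i - ∑ j, M.edgeProb i j| + p * M.θ i ^ 2) := by
        refine Finset.sum_le_sum fun i _ => ?_
        have hi := hM.sum_edgeProb i
        rw [← hK, ← hκ] at hi
        have e : CMM.deg (G ω) i - M.θ i * κ
            = (CMM.deg (G ω) i - ∑ j, M.edgeProb i j) + -(p * M.θ i ^ 2) := by rw [hi]; ring
        rw [e]
        refine (abs_add_le _ _).trans (le_of_eq ?_)
        rw [abs_neg, abs_of_nonneg (by positivity : 0 ≤ p * M.θ i ^ 2)]
      rw [Finset.sum_add_distrib] at this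
      linarith
    have hmain := hM.weightedNorm_le hlam hκ0.le hl.le hu.le h2 hD hY
    rw [← Finset.sum_mul, hM.sum_theta] at hmain
    have hlk : lam * κ ^ 2 ≤ p := by linarith
    set ρ : ℝ := r * p / K with hρ
    have hρ0 : 0 ≤ ρ := by positivity
    have e1 : lam * (r * g * κ) ≤ ρ := by
      have : lam * (r * g * κ) = r * (lam * κ ^ 2) / K := by
        rw [eq_div_iff hK0.ne', hκ]; ring
      rw [this, hρ]
      gcongr
    have e2 : lam * (2 * (r * g * κ) * (101 * s) + (101 * s) ^ 2)
        = lam * (r * g * κ) * (202 * s + 10201 * n) := by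
      rw [mul_pow, hs2]; ring
    have e3 : lam * (r * g * κ) * (202 * s + 10201 * n) ≤ ρ * (202 * s + 10201 * n) := by gcongr
    rw [e2] at hmain
    have e4 : 0 ≤ ρ * s := by positivity
    have e5 : 0 ≤ ρ * n := by positivity
    -- The largest coefficient is 101² = 10201, so 20000 is a generous choice.
    have hfin : δ * M.weightedNorm (M.trueY - Y) ≤ 20000 * ((1 + ρ) * (n + s)) := by linarith
    calc M.weightedNorm (M.trueY - Y) ≤ 20000 * ((1 + ρ) * (n + s)) / δ := by
          rwa [le_div_iff₀' hδ]
      _ ≤ 20000 * ((1 + ρ) * (n + r * g * √(n * p))) / δ := by gcongr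
      _ = _ := by ring
  have h1 := measureReal_mono (μ := P) hsub
  rw [probReal_univ] at h1
  have h2 := h1.trans ((measureReal_union_le _ _).trans
    (add_le_add_right (measureReal_union_le _ _) _))
  have h0 : 0 ≤ (Real.exp 1 / 2) ^ (-(2 * (n : ℝ))) := by positivity
  linarith

end DCSBM

theorem corollary1 :
    ∃ C₁ : ℝ, 0 < C₁ ∧ ∃ C₂ : ℝ, 0 < C₂ ∧
      ∀ (n r : ℕ) (p q g δ lam : ℝ) (M : DCSBM n r), M.IsFModel p q g →
        0 ≤ q → 0 < δ → 2 * δ < p - q →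
        (q + δ) / ((p + ((r : ℝ) - 1) * q) ^ 2 * g ^ 2) < lam →
        lam < (p - δ) / ((p + ((r : ℝ) - 1) * q) ^ 2 * g ^ 2) →
        (∀ (Ω : Type*) [MeasurableSpace Ω] (P : Measure Ω) [IsProbabilityMeasure P]
          (G : Ω → SimpleGraph (Fin n)), M.IsRandomGraph P G →
          0.99 - 2 * (Real.exp 1 / 2) ^ (-(2 * (n : ℝ))) ≤
            P.real {ω | ∀ Y : Matrix (Fin n) (Fin n) ℝ, CMM.IsSolution (G ω) lam Y →
              M.weightedNorm (M.trueY - Y) ≤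
                C₁ * (1 / δ * (1 + r * p / (p + ((r : ℝ) - 1) * q)) *
                  (n + r * g * √(n * p)))}) ∧
        1 / δ * (1 + r * p / (p + ((r : ℝ) - 1) * q)) * (n + r * g * √(n * p)) ≤
          C₂ * (1 / δ * r * (n + r * g * √(n * p))) := by
  refine ⟨20000, by norm_num, 2, by norm_num, fun n r p q g δ lam M hM hq hδ hpq hl hu => ⟨?_, ?_⟩⟩
  · intro Ω _ P _ G hG
    rcases Nat.eq_zero_or_pos n with rfl | hn
    -- For n = 0 the claimed lower bound 0.99 - 2 is negative.
    · refine le_trans ?_ measureReal_nonneg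
      norm_num
    · have hr : 0 < r := (Nat.zero_le _).trans_lt (M.cluster ⟨0, hn⟩).2
      exact hM.le_measure_weightedNorm_le hn hr hq hδ hpq hl hu hG
  · rcases Nat.eq_zero_or_pos r with rfl | hr
    · have hn : n = 0 := by
        by_contra h
        exact (M.cluster ⟨0, Nat.pos_of_ne_zero h⟩).elim0
      subst hn
      simp
    · have hr1 : (1 : ℝ) ≤ r := by exact_mod_cast hr
      have hg : 0 ≤ g := by
        rw [← hM.weight ⟨0, hr⟩]
        exact Finset.sum_nonneg fun i _ => M.θ_nonneg i
      have hp : 0 < p := by linarith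
      have hpK : p ≤ p + ((r : ℝ) - 1) * q := by
        have := mul_nonneg (by linarith : 0 ≤ (r : ℝ) - 1) hq
        linarith
      have hratio : r * p / (p + ((r : ℝ) - 1) * q) ≤ r := by
        rw [div_le_iff₀ (by linarith)]
        gcongr
      -- The constant 2 comes from 1 + r ≤ 2r, as r ≥ 1.
      calc _ ≤ 1 / δ * (2 * r) * (n + r * g * √(n * p)) := by
            gcongr
            linarith
        _ = _ := by ring
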